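/- Let $p$ be an odd prime, let $m,s$ be positive integers, and let $\mathbb F_{p^m}$ be a field with $p^m$ elements. For $\lambda\in\mathbb F_{p^m}\setminus\{0\}$, a $\lambda$-cyclic (constacyclic) code of length $N$ over $\mathbb F_{p^m}$ is a linear subspace of $\mathbb F_{p^m}^N$ closed under $(c_0,\dots,c_{N-1})\mapsto(\lambda c_{N-1},c_0,\dots,c_{N-2})$. Identify a word $(c_0,\dots,c_{N-1})$ with the class of $c_0+c_1x+\dots+c_{N-1}x^{N-1}$ in $\mathbb F_{p^m}[x]/\langle x^N-\lambda\rangle$. The Hamming distance $d_H(C)$ of a nonzero linear code $C$ is the minimum number of nonzero entries of a nonzero word of $C$. Let $\eta$ be a positive integer and let $\lambda,\xi,\psi\in\mathbb F_{p^m}\setminus\{0\}$ satisfy $\lambda=\psi^{p^s}$ and $x^{2\eta}-\psi=(x^\eta-\xi)(x^\eta+\xi)$, where both factors $x^\eta-\xi$ and $x^\eta+\xi$ are irreducible over $\mathbb F_{p^m}$. Then the $\lambda$-cyclic codes of length $2\eta p^s$ over $\mathbb F_{p^m}$ are exactly the ideals $$C_{i,j}=\langle (x^\eta-\xi)^i(x^\eta+\xi)^j\rangle\subset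 \mathbb F_{p^m}[x]/\langle x^{2\eta p^s}-\lambda\rangle,\qquad 0\le i,j\le p^s .$$ Moreover $C_{0,0}$ is the whole space $\mathbb F_{p^m}^{2\eta p^s}$ and $C_{p^s,p^s}=\{0\}$. For all other pairs $(i,j)$ with $0\le i,j\le p^s$, the Hamming distance is given by the following table. Write $B_\beta=\{t\in\mathbb Z:\beta p^{s-1}+1\le t\le(\beta+1)p^{s-1}\}$ and $T_{k,\tau}=\{t\in\mathbb Z:p^s-p^{s-k}+(\tau-1)p^{s-k-1}+1\le t\le p^s-p^{s-k}+\tau p^{s-k-1}\}$, where the parameters are integers with $1\le\beta'\le\beta\le p-2$, $1\le\tau,\tau_3,\tau_4\le p-1$, $1\le\tau_2<\tau_1\le p-1$, $1\le k\le s-1$ and $1\le k''<k'\le s-1$. 1. $0<i\le p^s$, $j=0$: $d_H=2$. 2. $0\le i\le p^{s-1}$, $0\le j\le p^{s-1}$: $d_H=2$. 3. $p^{s-1}<i\le 2p^{s-1}$, $0<j\le p^{s-1}$: $d_H=3$. 4. $2p^{s-1}<i\le p^s$, $0<j\le p^{s-1}$: $d_H=4$. 5. $i\in B_\beta$, $j\in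 B_{\beta'}$: $d_H=\min\{\beta+2,\,2(\beta'+2)\}$. 6. $i\in T_{k,\tau}$, $j\in B_\beta$: $d_H=2(\beta+2)$. 7. $i\in T_{k,\tau}$, $j\in T_{k,\tau}$: $d_H=(\tau+1)p^k$. 8. $i\in T_{k,\tau_1}$, $j\in T_{k,\tau_2}$: $d_H=\min\{2(\tau_2+1)p^k,\,(\tau_1+1)p^k\}$. 9. $i\in T_{k',\tau_3}$, $j\in T_{k'',\tau_4}$: $d_H=2(\tau_4+1)p^{k''}$. 10. $i=p^s$, $j\in B_\beta$: $d_H=2(\beta+2)$. 11. $i=p^s$, $j\in T_{k,\tau}$: $d_H=2(\tau+1)p^k$. Every row also holds with the roles of $i$ and $j$ interchanged, i.e. $d_H(C_{j,i})$ is equal to the same value, and the rows together with these symmetric versions cover all pairs $(i,j)$ with $0\le i,j\le p^s$ other than $(0,0)$ and $(p^s,p^s)$. Finally, unless $p\equiv 3\pmod 4$ and $m$ is odd, the above applies to the negacyclic codes of length $2p^s$: one has $-1=(-1)^{p^s}$, and there is $\xi\in\mathbb F_{p^m}\setminus\{0\}$ with $x^2+1=(x-\xi)(x+\xi)$ and both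 factors irreducible, so that the hypotheses hold with $\eta=1$ and $\lambda=\psi=-1$. -/

import Mathlib

open Polynomial

namespace RepeatedRoot

variable {F : Type*} [Field F]

/-- The `lam`-shift `(c₀, …, c_{N-1}) ↦ (lam * c_{N-1}, c₀, …, c_{N-2})` of a word of length `N`. -/
def constaShift {N : ℕ} (lam : F) (c : Fin N → F) : Fin N → F := fun i =>
  if (i : ℕ) = 0 then lam * c ⟨N - 1, Nat.sub_one_lt_of_lt i.isLt⟩
  else c ⟨(i : ℕ) - 1, lt_of_le_of_lt (Nat.sub_le _ _) i.isLt⟩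

/-- A linear code of length `N` over `F` is `lam`-cyclic (constacyclic) if it is closed under the
`lam`-shift. -/
def IsConstacyclic {N : ℕ} (lam : F) (D : Submodule F (Fin N → F)) : Prop :=
  ∀ c ∈ D, constaShift lam c ∈ D

/-- The ring `F[x] / ⟨x ^ N - lam⟩`. -/
abbrev Ambient (N : ℕ) (lam : F) : Type _ :=
  F[X] ⧸ Ideal.span {(X ^ N - C lam : F[X])}

/-- The identification of a word `(c₀, …, c_{N-1})` with the class of `c₀ + c₁ x + ⋯ +
c_{N-1} x ^ (N-1)` in `F[x] / ⟨x ^ N - lam⟩`. -/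
noncomputable def wordClass (N : ℕ) (lam : F) : (Fin N → F) →ₗ[F] Ambient N lam :=
  Fintype.linearCombination F fun i : Fin N =>
    Ideal.Quotient.mk (Ideal.span {(X ^ N - C lam : F[X])}) (X ^ (i : ℕ))

/-- An ideal of `F[x] / ⟨x ^ N - lam⟩` regarded as a linear code of length `N`. -/
noncomputable def codeOfIdeal {N : ℕ} {lam : F} (I : Ideal (Ambient N lam)) :
    Submodule F (Fin N → F) :=
  (I.restrictScalars F).comap (wordClass N lam)

/-- The code `⟨(x ^ η - ξ) ^ i * (x ^ η + ξ) ^ j⟩ ⊆ F[x] / ⟨x ^ N - lam⟩`. -/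
noncomputable def codeIJ (N : ℕ) (lam : F) (η : ℕ) (ξ : F) (i j : ℕ) :
    Submodule F (Fin N → F) :=
  codeOfIdeal (Ideal.span
    {Ideal.Quotient.mk (Ideal.span {(X ^ N - C lam : F[X])})
      ((X ^ η - C ξ) ^ i * (X ^ η + C ξ) ^ j)})

/-- `d` is the Hamming distance of the linear code `D`: the minimum of the Hamming weights
of the nonzero codewords (in particular, there is a nonzero codeword). -/
def HasHammingDistance [DecidableEq F] {N : ℕ} (D : Submodule F (Fin N → F)) (d : ℕ) : Prop :=
  IsLeast {w : ℕ | ∃ c ∈ D, c ≠ 0 ∧ hammingNorm c = w} d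

/-- `β p ^ (s-1) + 1 ≤ i ≤ (β + 1) p ^ (s-1)`. -/
def InBetaBlock (p s β i : ℕ) : Prop :=
  β * p ^ (s - 1) + 1 ≤ i ∧ i ≤ (β + 1) * p ^ (s - 1)

/-- `p ^ s - p ^ (s-k) + (τ-1) p ^ (s-k-1) + 1 ≤ i ≤ p ^ s - p ^ (s-k) + τ p ^ (s-k-1)`;
used only for `1 ≤ k ≤ s - 1` and `1 ≤ τ`, where no subtraction is truncated. -/
def InTauBlock (p s k τ i : ℕ) : Prop :=
  p ^ s - p ^ (s - k) + (τ - 1) * p ^ (s - k - 1) + 1 ≤ i ∧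
    i ≤ p ^ s - p ^ (s - k) + τ * p ^ (s - k - 1)

/-- The table of Hamming distances: `DistanceTable p s i j d` says that some row of the table
applies to the pair of exponents `(i, j)` and has the entry `d`. -/
inductive DistanceTable (p s : ℕ) : ℕ → ℕ → ℕ → Prop
  | right_zero (i : ℕ) (hi : 0 < i) (hi' : i ≤ p ^ s) : DistanceTable p s i 0 2
  | both_small (i j : ℕ) (hi : i ≤ p ^ (s - 1)) (hj : j ≤ p ^ (s - 1)) :
      DistanceTable p s i j 2
  | three (i j : ℕ) (hi : p ^ (s - 1) < i) (hi' : i ≤ 2 * p ^ (s - 1))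
      (hj : 0 < j) (hj' : j ≤ p ^ (s - 1)) : DistanceTable p s i j 3
  | four (i j : ℕ) (hi : 2 * p ^ (s - 1) < i) (hi' : i ≤ p ^ s)
      (hj : 0 < j) (hj' : j ≤ p ^ (s - 1)) : DistanceTable p s i j 4
  | beta_beta (i j β β' : ℕ) (hβ' : 1 ≤ β') (hβ : β' ≤ β) (hβp : β ≤ p - 2)
      (hi : InBetaBlock p s β i) (hj : InBetaBlock p s β' j) :
      DistanceTable p s i j (min (β + 2) (2 * (β' + 2)))
  | tau_beta (i j k τ β : ℕ) (hk : 1 ≤ k) (hk' : k ≤ s - 1) (hτ : 1 ≤ τ) (hτ' : τ ≤ p - 1)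
      (hβ : 1 ≤ β) (hβ' : β ≤ p - 2)
      (hi : InTauBlock p s k τ i) (hj : InBetaBlock p s β j) :
      DistanceTable p s i j (2 * (β + 2))
  | tau_eq (i j k τ : ℕ) (hk : 1 ≤ k) (hk' : k ≤ s - 1) (hτ : 1 ≤ τ) (hτ' : τ ≤ p - 1)
      (hi : InTauBlock p s k τ i) (hj : InTauBlock p s k τ j) :
      DistanceTable p s i j ((τ + 1) * p ^ k)
  | tau_lt (i j k τ₁ τ₂ : ℕ) (hk : 1 ≤ k) (hk' : k ≤ s - 1)
      (hτ₂ : 1 ≤ τ₂) (hτ : τ₂ < τ₁) (hτ₁ : τ₁ ≤ p - 1)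
      (hi : InTauBlock p s k τ₁ i) (hj : InTauBlock p s k τ₂ j) :
      DistanceTable p s i j (min (2 * (τ₂ + 1) * p ^ k) ((τ₁ + 1) * p ^ k))
  | level_lt (i j k' k'' τ₃ τ₄ : ℕ) (hk'' : 1 ≤ k'') (hk : k'' < k') (hk' : k' ≤ s - 1)
      (hτ₃ : 1 ≤ τ₃) (hτ₃' : τ₃ ≤ p - 1) (hτ₄ : 1 ≤ τ₄) (hτ₄' : τ₄ ≤ p - 1)
      (hi : InTauBlock p s k' τ₃ i) (hj : InTauBlock p s k'' τ₄ j) :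
      DistanceTable p s i j (2 * (τ₄ + 1) * p ^ k'')
  | full_beta (j β : ℕ) (hβ : 1 ≤ β) (hβ' : β ≤ p - 2) (hj : InBetaBlock p s β j) :
      DistanceTable p s (p ^ s) j (2 * (β + 2))
  | full_tau (j k τ : ℕ) (hk : 1 ≤ k) (hk' : k ≤ s - 1) (hτ : 1 ≤ τ) (hτ' : τ ≤ p - 1)
      (hj : InTauBlock p s k τ j) :
      DistanceTable p s (p ^ s) j (2 * (τ + 1) * p ^ k)

end RepeatedRoot

/-! Distances reduce in three stages to powers of one linear factor. Substituting `X ^ η` for `X`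
does not change minimum weights: splitting a polynomial by exponents modulo `η` gives slices that
inherit the divisibility and whose weights add up to the total (`isLeast_polyWeights_expand`). So it
suffices to treat `(X - ξ) ^ i * (X + ξ) ^ j` with length `2 * p ^ s`.

For `j ≤ i`, splitting into even and odd parts gives `min d_i (2 * d_j)`, where `d_e` is the minimum
weight of nonzero multiples of `(X - a) ^ e` of degree below `p ^ s`
(`isLeast_polyWeights_two_roots`). If `i = p ^ s` there is no such multiple, and the value is `2 *
d_j` (`isLeast_polyWeights_full`).

The number `d_e` comes from the bound `digitWeight_le_card_support`: a polynomial with a nonzero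
root of exact multiplicity `e` has weight at least the product of `d + 1` over the base-`p` digits
`d` of `e`. Minimising over the admissible multiplicities gives `(τ + 1) * p ^ k` on each block
(`isLeast_polyWeights_single`). The table is then arithmetic with these minima.

The classification of codes is that of ideals in a quotient of a principal ideal domain: generators
are divisors of `X ^ N - lam`, a product of `p ^ s`-th powers of two irreducibles. -/

namespace RepeatedRoot

/-! ### Splitting a polynomial by exponents modulo `n` -/

section Slice

variable {F : Type*} [Field F]

/-- The polynomial formed by the coefficients of `f` at the exponents `n * k + r`. -/
noncomputable def slice (n r : ℕ) (f : F[X]) : F[X] :=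
  ∑ k ∈ Finset.range (f.natDegree + 1), monomial k (f.coeff (n * k + r))

theorem coeff_slice {n : ℕ} (hn : 0 < n) (r : ℕ) (f : F[X]) (k : ℕ) :
    (slice n r f).coeff k = f.coeff (n * k + r) := by
  simp only [slice, finsetSum_coeff, coeff_monomial, Finset.sum_ite_eq', Finset.mem_range]
  split_ifs with h
  · rfl
  · rw [coeff_eq_zero_of_natDegree_lt]
    nlinarith

theorem slice_add {n : ℕ} (hn : 0 < n) (r : ℕ) (f g : F[X]) :
    slice n r (f + g) = slice n r f + slice n r g := by
  ext k
  simp [coeff_slice hn]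

/-- Slicing is linear over polynomials in `X ^ n`; this is how slices inherit divisibility. -/
theorem slice_expand_mul {n r : ℕ} (hr : r < n) (q f : F[X]) :
    slice n r (expand F n q * f) = q * slice n r f := by
  have hn : 0 < n := by omega
  induction q using Polynomial.induction_on' with
  | add p q hp hq => rw [map_add, add_mul, slice_add hn, hp, hq, add_mul]
  | monomial d a =>
    ext k
    rw [expand_monomial, coeff_slice hn, ← C_mul_X_pow_eq_monomial, ← C_mul_X_pow_eq_monomial,
      mul_assoc, mul_assoc, coeff_C_mul, coeff_C_mul, coeff_X_pow_mul', coeff_X_pow_mul',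
      coeff_slice hn]
    by_cases h : d ≤ k
    · obtain ⟨l, rfl⟩ := Nat.exists_eq_add_of_le h
      rw [if_pos h, if_pos (by nlinarith)]
      congr 3
      rw [Nat.add_sub_cancel_left, mul_comm d n, mul_add, add_assoc, Nat.add_sub_cancel_left]
    · have : n * (k + 1) ≤ n * d := Nat.mul_le_mul_left n (by omega)
      rw [if_neg h, if_neg]
      rw [mul_comm d n]
      rw [mul_add] at this
      omega

theorem sum_X_pow_mul_expand_slice {n : ℕ} (hn : 0 < n) (f : F[X]) :
    ∑ r ∈ Finset.range n, X ^ r * expand F n (slice n r f) = f := by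
  ext k
  simp only [finsetSum_coeff, coeff_X_pow_mul', coeff_expand hn, coeff_slice hn]
  rw [Finset.sum_eq_single (k % n)]
  · have h1 := Nat.mod_add_div k n
    have h2 : k - k % n = n * (k / n) := by omega
    rw [if_pos (Nat.mod_le k n), h2, if_pos (dvd_mul_right _ _), Nat.mul_div_cancel_left _ hn,
      add_comm, h1]
  · intro b hb hbk
    split_ifs with h h' <;> try rfl
    obtain ⟨c, hc⟩ := h'
    refine absurd ?_ hbk
    have : k = b + n * c := by omega
    rw [this, Nat.add_mul_mod_self_left, Nat.mod_eq_of_lt (Finset.mem_range.1 hb)]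
  · intro h
    exact absurd (Finset.mem_range.2 (Nat.mod_lt _ hn)) h

theorem sum_card_support_slice {n : ℕ} (hn : 0 < n) (f : F[X]) :
    ∑ r ∈ Finset.range n, (slice n r f).support.card = f.support.card := by
  rw [Finset.card_eq_sum_card_fiberwise (f := fun k => k % n) (t := Finset.range n)
    (fun k _ => by simpa using Nat.mod_lt k hn)]
  refine Finset.sum_congr rfl fun r hr => ?_
  have hr := Finset.mem_range.1 hr
  refine Finset.card_bij' (fun k _ => n * k + r) (fun k _ => k / n) ?_ ?_ ?_ ?_
  · intro k hk
    simp only [Finset.mem_filter, mem_support_iff, coeff_slice hn] at hk ⊢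
    exact ⟨hk, by rw [Nat.mul_add_mod, Nat.mod_eq_of_lt hr]⟩
  · intro k hk
    simp only [Finset.mem_filter, mem_support_iff, coeff_slice hn] at hk ⊢
    rw [← hk.2, Nat.div_add_mod]
    exact hk.1
  · intro k _
    rw [Nat.mul_add_div hn, Nat.div_eq_of_lt hr, add_zero]
  · intro k hk
    simp only [Finset.mem_filter] at hk
    rw [← hk.2, Nat.div_add_mod]

theorem card_support_slice_le {n r : ℕ} (hr : r < n) (f : F[X]) :
    (slice n r f).support.card ≤ f.support.card := by
  rw [← sum_card_support_slice (by omega : 0 < n) f]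
  exact Finset.single_le_sum (f := fun r => (slice n r f).support.card) (fun _ _ => Nat.zero_le _)
    (Finset.mem_range.2 hr)

theorem degree_slice_lt {n : ℕ} (hn : 0 < n) (r : ℕ) {f : F[X]} {L : ℕ}
    (h : f.degree < (n * L : ℕ)) : (slice n r f).degree < L := by
  rw [degree_lt_iff_coeff_zero] at h ⊢
  intro m hm
  rw [coeff_slice hn]
  exact h _ (by nlinarith)

theorem exists_slice_ne_zero {n : ℕ} (hn : 0 < n) {f : F[X]} (hf : f ≠ 0) :
    ∃ r < n, slice n r f ≠ 0 := by
  by_contra! h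
  refine hf ?_
  rw [← sum_X_pow_mul_expand_slice hn f]
  refine Finset.sum_eq_zero fun r hr => ?_
  rw [h r (Finset.mem_range.1 hr), map_zero, mul_zero]

theorem dvd_slice {n r : ℕ} (hr : r < n) {q f : F[X]} (h : expand F n q ∣ f) :
    q ∣ slice n r f := by
  obtain ⟨g, rfl⟩ := h
  rw [slice_expand_mul hr]
  exact dvd_mul_right _ _

theorem slice_zero_expand {n : ℕ} (hn : 0 < n) (g : F[X]) : slice n 0 (expand F n g) = g := by
  ext k
  rw [coeff_slice hn, add_zero, mul_comm, coeff_expand_mul hn]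

theorem expand_dvd_expand (n : ℕ) {G g : F[X]} (h : G ∣ g) : expand F n G ∣ expand F n g := by
  obtain ⟨q, rfl⟩ := h
  rw [map_mul]
  exact dvd_mul_right _ _

theorem card_support_expand {n : ℕ} (hn : 0 < n) (g : F[X]) :
    (expand F n g).support.card = g.support.card := by
  have h := Finset.card_image_of_injective g.support
    (f := fun k => k * n) (fun a b hab => Nat.eq_of_mul_eq_mul_right hn hab)
  rw [← h]
  congr 1
  ext k
  rw [mem_support_iff, coeff_expand hn, Finset.mem_image]
  constructor
  · intro hk
    split_ifs at hk with hd
    · exact ⟨k / n, mem_support_iff.2 hk, Nat.div_mul_cancel hd⟩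
    · exact absurd rfl hk
  · rintro ⟨l, hl, rfl⟩
    rw [if_pos (dvd_mul_left _ _), Nat.mul_div_cancel _ hn]
    exact mem_support_iff.1 hl

end Slice

/-! ### Lower bound for the weight from the multiplicity of a root -/

section Weight

variable {F : Type*} [Field F]

/-- Factors `X` change neither weight nor multiplicity at `a`. Once the constant term is nonzero,
differentiation removes at least one term and lowers the guaranteed multiplicity by only one, so
induction on the degree applies. -/
theorem lt_card_support_of_natDegree_lt_char (p : ℕ) [Fact p.Prime] [CharP F p] {a : F}
    (ha : a ≠ 0) {f : F[X]} (hf : f ≠ 0) (hdeg : f.natDegree < p) {e : ℕ}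
    (h : (X - C a) ^ e ∣ f) : e < f.support.card := by
  induction hN : f.natDegree using Nat.strong_induction_on generalizing f e with
  | _ N ih =>
    subst hN
    by_cases h0 : f.coeff 0 = 0
    · obtain ⟨g, rfl⟩ := X_dvd_iff.2 h0
      have hg : g ≠ 0 := right_ne_zero_of_mul hf
      have hd : (X * g).natDegree = g.natDegree + 1 := natDegree_X_mul hg
      have hcop : IsCoprime ((X - C a) ^ e) (X : F[X]) := by
        refine IsCoprime.pow_left ?_
        have := isCoprime_X_sub_C_of_isUnit_sub (a := a) (b := 0) (by simpa using ha)
        simpa using this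
      have := ih g.natDegree (by omega) hg (by omega) (hcop.dvd_of_dvd_mul_left h) rfl
      have : g.support.card ≤ (X * g).support.card := by
        refine Finset.card_le_card_of_injOn (· + 1) ?_ (fun _ _ _ _ h => by simpa using h)
        intro k hk
        simpa [coeff_X_mul] using hk
      omega
    · rcases Nat.eq_zero_or_pos e with rfl | he
      · exact Finset.card_pos.2 (nonempty_support_iff.2 hf)
      have hsupp : (derivative f).support.card + 1 ≤ f.support.card := by
        rw [← Finset.card_erase_add_one (mem_support_iff.2 h0)]
        refine Nat.add_le_add_right
          (Finset.card_le_card_of_injOn (· + 1) ?_ (fun _ _ _ _ h => by simpa using h)) 1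
        intro k hk
        simp only [Finset.mem_coe, mem_support_iff, coeff_derivative] at hk
        simpa using left_ne_zero_of_mul hk
      obtain ⟨e, rfl⟩ := Nat.exists_eq_succ_of_ne_zero he.ne'
      have hdpos : 0 < f.natDegree := by
        have := natDegree_le_of_dvd h hf
        rw [natDegree_pow, natDegree_X_sub_C] at this
        omega
      -- The degree is positive and below `p`, so differentiation keeps the leading term alive.
      have hder : derivative f ≠ 0 := by
        intro h0
        have h1 := congrArg (fun g => coeff g (f.natDegree - 1)) h0
        simp only [coeff_derivative, coeff_zero] at h1
        rw [Nat.sub_add_cancel hdpos] at h1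
        have h2 : ((f.natDegree : ℕ) : F) = 0 := by
          have := (mul_eq_zero.1 h1).resolve_left (leadingCoeff_ne_zero.2 hf)
          rw [← this]
          have : f.natDegree = (f.natDegree - 1) + 1 := by omega
          conv_lhs => rw [this]
          push_cast
          rfl
        exact absurd (Nat.le_of_dvd hdpos ((CharP.cast_eq_zero_iff F p _).1 h2)) (by omega)
      have hdlt := natDegree_derivative_lt (p := f) hdpos.ne'
      have hdvd : (X - C a) ^ e ∣ derivative f := by
        obtain ⟨g, rfl⟩ := h
        rw [derivative_mul, derivative_pow]
        refine dvd_add ?_ ?_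
        · refine Dvd.dvd.mul_right (Dvd.dvd.mul_right (Dvd.dvd.mul_left ?_ _) _) _
          simp
        · exact Dvd.dvd.mul_right (pow_dvd_pow _ (Nat.le_succ e)) _
      have := ih _ hdlt hder (by omega) hdvd rfl
      omega

/-- The product of the numbers `d + 1`, where `d` runs through the base-`p` digits of `e`. -/
def digitWeight (p e : ℕ) : ℕ := ((Nat.digits p e).map (· + 1)).prod

@[simp]
theorem digitWeight_zero (p : ℕ) : digitWeight p 0 = 1 := by simp [digitWeight]

theorem digitWeight_eq {p : ℕ} (hp : 1 < p) (e : ℕ) :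
    digitWeight p e = (e % p + 1) * digitWeight p (e / p) := by
  rcases Nat.eq_zero_or_pos e with rfl | he
  · simp
  · simp [digitWeight, Nat.digits_def' hp he]

theorem X_sub_C_pow_char_pow (p : ℕ) [Fact p.Prime] [CharP F p] (a : F) (t e : ℕ) :
    (X - C a : F[X]) ^ (p ^ t * e) = expand F (p ^ t) ((X - C (a ^ p ^ t)) ^ e) := by
  rw [pow_mul, sub_pow_char_pow, map_pow, map_sub, expand_X, expand_C, C_pow]

/-- Induction on the digits. The slices modulo `p` are `(X - a ^ p) ^ (e / p)` times the slices of
`H`, and the induction hypothesis applies to each slice of `H` that does not vanish at `a ^ p`. It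
remains to see that more than `e % p` of them do not vanish there. -/
theorem digitWeight_le_card_support (p : ℕ) [hp : Fact p.Prime] [CharP F p] (e : ℕ) {a : F}
    (ha : a ≠ 0) {h : F[X]} (hh : h.eval a ≠ 0) :
    digitWeight p e ≤ ((X - C a) ^ e * h).support.card := by
  induction e using Nat.strong_induction_on generalizing a h with
  | _ e ih =>
    have hne : (X - C a) ^ e * h ≠ 0 :=
      mul_ne_zero (pow_ne_zero _ (X_sub_C_ne_zero a)) (by rintro rfl; simp at hh)
    rcases Nat.eq_zero_or_pos e with rfl | he
    · rw [digitWeight_zero]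
      exact Finset.card_pos.2 (nonempty_support_iff.2 hne)
    have hp1 := hp.out.one_lt
    have hp0 : 0 < p := by omega
    rw [digitWeight_eq hp1]
    set H : F[X] := (X - C a) ^ (e % p) * h with hH
    have hf : (X - C a) ^ e * h = expand F p ((X - C (a ^ p)) ^ (e / p)) * H := by
      have := X_sub_C_pow_char_pow p a 1 (e / p)
      rw [pow_one] at this
      rw [← this, hH, ← mul_assoc, ← pow_add, Nat.div_add_mod]
    -- `K` is the remainder of `H` modulo `X ^ p - a ^ p = (X - a) ^ p`; its support is the set of
    -- slices of `H` not vanishing at `a ^ p`.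
    set K : F[X] := ∑ r ∈ Finset.range p, monomial r ((slice p r H).eval (a ^ p)) with hK
    have hKc : ∀ r, K.coeff r = if r < p then (slice p r H).eval (a ^ p) else 0 := by
      intro r
      simp [hK, coeff_monomial]
    have hHK : (X - C a) ^ p ∣ H - K := by
      have h1 : H - K = ∑ r ∈ Finset.range p,
          X ^ r * expand F p (slice p r H - C ((slice p r H).eval (a ^ p))) := by
        conv_lhs => rw [← sum_X_pow_mul_expand_slice hp0 H]
        rw [hK, ← Finset.sum_sub_distrib]
        refine Finset.sum_congr rfl fun r _ => ?_
        rw [map_sub, expand_C, mul_sub, ← C_mul_X_pow_eq_monomial, mul_comm (C _)]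
      rw [h1]
      refine Finset.dvd_sum fun r _ => Dvd.dvd.mul_left ?_ _
      have h2 : (X - C a : F[X]) ^ p = expand F p (X - C (a ^ p)) := by
        simpa using X_sub_C_pow_char_pow p a 1 1
      rw [h2]
      exact expand_dvd_expand p X_sub_C_dvd_sub_C_eval
    have hmod : e % p < p := Nat.mod_lt _ hp0
    have hKdvd : (X - C a) ^ (e % p) ∣ K :=
      (dvd_sub_right (dvd_mul_right _ _)).1 ((pow_dvd_pow _ hmod.le).trans hHK)
    -- Otherwise `(X - a) ^ p` divides `H`, whose multiplicity at `a` is exactly `e % p < p`.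
    have hK0 : K ≠ 0 := by
      intro h0
      rw [h0, sub_zero, hH] at hHK
      have h1 : (X - C a) ^ (e % p + 1) ∣ (X - C a) ^ (e % p) * h :=
        (pow_dvd_pow _ hmod).trans hHK
      rw [pow_succ] at h1
      have h2 := (mul_dvd_mul_iff_left (pow_ne_zero _ (X_sub_C_ne_zero a))).1 h1
      exact hh (dvd_iff_isRoot.1 h2)
    have hKdeg : K.natDegree < p := by
      rw [natDegree_lt_iff_degree_lt hK0, degree_lt_iff_coeff_zero]
      intro m hm
      rw [hKc, if_neg (by omega)]
    have hcard := lt_card_support_of_natDegree_lt_char p ha hK0 hKdeg hKdvd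
    have hsub : K.support ⊆ Finset.range p := fun r hr => by
      rw [mem_support_iff, hKc] at hr
      by_contra h'
      exact hr (if_neg (by simpa using h'))
    calc (e % p + 1) * digitWeight p (e / p) ≤ K.support.card * digitWeight p (e / p) :=
          Nat.mul_le_mul_right _ hcard
      _ = ∑ r ∈ K.support, digitWeight p (e / p) := by simp
      _ ≤ ∑ r ∈ K.support, (slice p r ((X - C a) ^ e * h)).support.card := by
          refine Finset.sum_le_sum fun r hr => ?_
          have hrp := Finset.mem_range.1 (hsub hr)
          rw [hf, slice_expand_mul hrp]
          refine ih _ (Nat.div_lt_self he hp1) (pow_ne_zero _ ha) ?_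
          rw [mem_support_iff, hKc, if_pos hrp] at hr
          exact hr
      _ ≤ ∑ r ∈ Finset.range p, (slice p r ((X - C a) ^ e * h)).support.card :=
          Finset.sum_le_sum_of_subset hsub
      _ = _ := sum_card_support_slice hp0 _

end Weight

end RepeatedRoot

namespace RepeatedRoot

/-! ### Arithmetic of digit weights -/

section Digits

theorem digitWeight_mul_add {p : ℕ} (hp : 1 < p) (a : ℕ) {t b : ℕ} (hb : b < p ^ t) :
    digitWeight p (p ^ t * a + b) = digitWeight p b * digitWeight p a := by
  induction t generalizing b with
  | zero =>
    obtain rfl : b = 0 := by simpa using hb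
    simp
  | succ t ih =>
    have h1 : p ^ (t + 1) * a + b = b + p * (p ^ t * a) := by ring
    have h2 : b / p < p ^ t := Nat.div_lt_of_lt_mul (by rwa [pow_succ'] at hb)
    rw [digitWeight_eq hp, h1, Nat.add_mul_mod_self_left, Nat.add_mul_div_left _ _ (by omega),
      add_comm, digitWeight_eq hp b, add_comm (b / p), ih h2]
    ring

theorem digitWeight_of_lt {p : ℕ} (hp : 1 < p) {c : ℕ} (hc : c < p) :
    digitWeight p c = c + 1 := by
  rw [digitWeight_eq hp, Nat.mod_eq_of_lt hc, Nat.div_eq_of_lt hc, digitWeight_zero, mul_one]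

theorem digitWeight_pow_sub_one {p : ℕ} (hp : 1 < p) (k : ℕ) :
    digitWeight p (p ^ k - 1) = p ^ k := by
  induction k with
  | zero => simp
  | succ k ih =>
    have hk : 0 < p ^ k := by positivity
    have h1 : p ^ (k + 1) - 1 = p ^ k * (p - 1) + (p ^ k - 1) := by
      rw [pow_succ, Nat.mul_sub, mul_one]
      have : p ^ k ≤ p ^ k * p := Nat.le_mul_of_pos_right _ (by omega)
      omega
    rw [h1, digitWeight_mul_add hp _ (by omega), ih, digitWeight_of_lt hp (by omega),
      Nat.sub_add_cancel hp.le, pow_succ]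

theorem digitWeight_pos {p : ℕ} (e : ℕ) : 0 < digitWeight p e := by
  refine Nat.pos_of_ne_zero fun h => ?_
  rw [digitWeight, List.prod_eq_zero_iff] at h
  simp at h

theorem two_le_digitWeight {p : ℕ} (hp : 1 < p) {b : ℕ} (hb : 0 < b) : 2 ≤ digitWeight p b := by
  induction b using Nat.strong_induction_on with
  | _ b ih =>
    rw [digitWeight_eq hp]
    rcases Nat.eq_zero_or_pos (b % p) with h | h
    · have h1 := Nat.mod_add_div b p
      have h2 : 0 < b / p := Nat.pos_of_ne_zero fun h0 => by simp [h, h0] at h1; omega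
      have := ih (b / p) (Nat.div_lt_self hb hp) h2
      rw [h]
      omega
    · have := digitWeight_pos (p := p) (b / p)
      nlinarith

/-- The lower bound for `e` has `k` leading digits `p - 1`, then `c`, then `t` zeros. A larger `e`
below `p ^ (t + k + 1)` keeps the leading digits. Either its next digit exceeds `c`, or that digit
is `c` and the nonzero tail contributes a factor at least `2`, with `2 * (c + 1) ≥ c + 2`. -/
theorem le_digitWeight {p : ℕ} (hp : 1 < p) {t k c e : ℕ}
    (he : p ^ t * (p * (p ^ k - 1) + c) < e) (he' : e < p ^ (t + k + 1)) :
    (c + 2) * p ^ k ≤ digitWeight p e := by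
  have ht : 0 < p ^ t := by positivity
  have hk : 0 < p ^ k := by positivity
  have hval : ∀ c < p, digitWeight p (p * (p ^ k - 1) + c) = (c + 1) * p ^ k := by
    intro c hc
    have := digitWeight_mul_add hp (p ^ k - 1) (t := 1) (b := c) (by simpa using hc)
    rw [pow_one] at this
    rw [this, digitWeight_of_lt hp hc, digitWeight_pow_sub_one hp]
  have hb : e % p ^ t < p ^ t := Nat.mod_lt _ ht
  have hdm := Nat.div_add_mod e (p ^ t)
  have ha : e / p ^ t < p * p ^ k := Nat.div_lt_of_lt_mul (by
    calc e < p ^ (t + k + 1) := he'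
      _ = p ^ t * (p * p ^ k) := by ring)
  have hmul : p * (p ^ k - 1) + p = p * p ^ k := by
    rw [← Nat.mul_succ]
    congr 1
    omega
  rw [← hdm, digitWeight_mul_add hp _ hb]
  have hle : p * (p ^ k - 1) + c ≤ e / p ^ t := (Nat.le_div_iff_mul_le ht).2 (by nlinarith)
  obtain ⟨d, hd⟩ := Nat.exists_eq_add_of_le hle
  have hd' : e / p ^ t = p * (p ^ k - 1) + (c + d) := by omega
  have hdp : c + d < p := by omega
  rw [hd', hval _ hdp]
  rcases Nat.eq_zero_or_pos d with rfl | hd0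
  · have h2 : 2 ≤ digitWeight p (e % p ^ t) := by
      refine two_le_digitWeight hp (Nat.pos_of_ne_zero fun h0 => ?_)
      rw [h0, hd'] at hdm
      simp at hdm
      omega
    calc (c + 2) * p ^ k ≤ 2 * ((c + 1) * p ^ k) := by nlinarith
      _ ≤ _ := Nat.mul_le_mul_right _ h2
  · calc (c + 2) * p ^ k ≤ 1 * ((c + d + 1) * p ^ k) := by
          rw [one_mul]
          exact Nat.mul_le_mul_right _ (by omega)
      _ ≤ _ := Nat.mul_le_mul_right _ (digitWeight_pos _)

/-- Puts block endpoints into the digit form used by `le_digitWeight`. -/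
theorem pow_sub_pow_add {p s k : ℕ} (hk : k < s) (c : ℕ) :
    p ^ s - p ^ (s - k) + c * p ^ (s - k - 1) = p ^ (s - k - 1) * (p * (p ^ k - 1) + c) := by
  obtain ⟨t, rfl⟩ : ∃ t, s = t + k + 1 := ⟨s - k - 1, by omega⟩
  have h1 : t + k + 1 - k = t + 1 := by omega
  rw [h1, Nat.add_sub_cancel, mul_add, ← mul_assoc, Nat.mul_sub, mul_one]
  congr 1
  · congr 1
    ring
  · ring

end Digits

/-! ### Minimum weights of multiples: one root, two opposite roots, substitution of `X ^ n` -/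

section PolyWeights

variable {F : Type*} [Field F]

/-- The weights of the nonzero multiples of `G` of degree less than `L`. -/
def polyWeights (G : F[X]) (L : ℕ) : Set ℕ :=
  {w | ∃ f : F[X], f ≠ 0 ∧ G ∣ f ∧ f.degree < L ∧ f.support.card = w}

theorem isLeast_polyWeights {G : F[X]} {L d : ℕ}
    (h : ∀ f : F[X], f ≠ 0 → G ∣ f → f.degree < L → d ≤ f.support.card)
    {g : F[X]} (hg : g ≠ 0) (hG : G ∣ g) (hL : g.degree < L) (hd : g.support.card ≤ d) :
    IsLeast (polyWeights G L) d := by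
  refine ⟨⟨g, hg, hG, hL, le_antisymm hd (h g hg hG hL)⟩, ?_⟩
  rintro w ⟨f, hf, hGf, hfL, rfl⟩
  exact h f hf hGf hfL

theorem isLeast_polyWeights_one {L : ℕ} (hL : 0 < L) : IsLeast (polyWeights (1 : F[X]) L) 1 := by
  refine isLeast_polyWeights (fun f hf _ _ => Finset.card_pos.2 (nonempty_support_iff.2 hf))
    one_ne_zero dvd_rfl ?_ ?_
  · rw [degree_one]
    exact_mod_cast hL
  · simpa using card_support_C_mul_X_pow_le_one (c := (1 : F)) (n := 0)

theorem card_support_X_sub_C_pow_le (b : F) (n : ℕ) :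
    ((X - C b) ^ n : F[X]).support.card ≤ n + 1 := by
  refine (card_supp_le_succ_natDegree _).trans ?_
  rw [natDegree_pow, natDegree_X_sub_C, mul_one]

theorem degree_X_sub_C_pow (b : F) (n : ℕ) : ((X - C b) ^ n : F[X]).degree = n := by
  simp

theorem isLeast_polyWeights_single (p : ℕ) [hp : Fact p.Prime] [CharP F p] {s k τ i : ℕ}
    (hk : k < s) (hτ : 1 ≤ τ) (hτ' : τ ≤ p - 1) (hi : InTauBlock p s k τ i) {a : F}
    (ha : a ≠ 0) :
    IsLeast (polyWeights ((X - C a) ^ i) (p ^ s)) ((τ + 1) * p ^ k) := by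
  have hp1 := hp.out.one_lt
  obtain ⟨hi1, hi2⟩ := hi
  rw [pow_sub_pow_add hk] at hi1 hi2
  obtain ⟨t, rfl⟩ : ∃ t, s = t + k + 1 := ⟨s - k - 1, by omega⟩
  have ht : t + k + 1 - k - 1 = t := by omega
  rw [ht] at hi1 hi2
  have hpk : 0 < p ^ k := by positivity
  have hpt : 0 < p ^ t := by positivity
  -- The exponent is the right end of the block. By Frobenius this power is a `(p ^ k - 1)`-th power
  -- of a binomial times a `τ`-th power of another, hence has at most `p ^ k * (τ + 1)` terms.
  refine isLeast_polyWeights (g := (X - C a) ^ (p ^ t * (p * (p ^ k - 1) + τ))) ?_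
    (pow_ne_zero _ (X_sub_C_ne_zero a)) (pow_dvd_pow _ hi2) ?_ ?_
  · intro f hf hdvd hdeg
    obtain ⟨h, hfh, hh⟩ := exists_eq_pow_rootMultiplicity_mul_and_not_dvd f hf a
    have hle : i ≤ rootMultiplicity a f := (le_rootMultiplicity_iff hf).2 hdvd
    have hlt : rootMultiplicity a f < p ^ (t + k + 1) := by
      refine lt_of_le_of_lt ?_ ((natDegree_lt_iff_degree_lt hf).2 hdeg)
      simpa using natDegree_le_of_dvd (pow_rootMultiplicity_dvd f a) hf
    have h1 := le_digitWeight hp1 (t := t) (k := k) (c := τ - 1)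
      (lt_of_lt_of_le hi1 hle) hlt
    have h2 : τ - 1 + 2 = τ + 1 := by omega
    rw [h2] at h1
    refine h1.trans ?_
    conv_rhs => rw [hfh]
    exact digitWeight_le_card_support p _ ha fun h0 => hh (dvd_iff_isRoot.2 h0)
  · rw [degree_X_sub_C_pow]
    have h1 : p * (p ^ k - 1) + p = p * p ^ k := by
      rw [← Nat.mul_succ]
      congr 1
      omega
    have h2 : p ^ (t + k + 1) = p ^ t * (p * p ^ k) := by ring
    rw [h2]
    exact_mod_cast Nat.mul_lt_mul_of_pos_left (by omega) hpt
  · have h1 : p ^ t * (p * (p ^ k - 1) + τ) = p ^ (t + 1) * (p ^ k - 1) + p ^ t * τ := by ring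
    rw [h1, pow_add, X_sub_C_pow_char_pow, X_sub_C_pow_char_pow]
    refine card_support_mul_le.trans ?_
    rw [card_support_expand (by positivity), card_support_expand hpt, mul_comm]
    refine Nat.mul_le_mul (card_support_X_sub_C_pow_le _ _) ?_
    refine (card_support_X_sub_C_pow_le _ _).trans ?_
    omega

theorem expand_two_eq {ξ : F} (n : ℕ) :
    expand F 2 ((X - C (ξ ^ 2)) ^ n) = (X - C ξ) ^ n * (X + C ξ) ^ n := by
  rw [← mul_pow, map_pow, map_sub, expand_X, expand_C, C_pow]
  ring

/-- An even polynomial is invariant under `X ↦ -X`, so `-ξ` is a root of at least the same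
multiplicity; the two powers are coprime as `ξ ≠ -ξ`. -/
theorem pow_dvd_of_dvd_expand_two (h2 : (2 : F) ≠ 0) {ξ : F} (hξ : ξ ≠ 0) {n : ℕ} {g : F[X]}
    (h : (X - C ξ) ^ n ∣ expand F 2 g) : (X - C (ξ ^ 2)) ^ n ∣ g := by
  have h' : (X + C ξ) ^ n ∣ expand F 2 g := by
    have h1 : (expand F 2 g).comp (-X) = expand F 2 g := by
      rw [expand_eq_comp_X_pow, comp_assoc]
      simp
    have h2 : ((X - C ξ) ^ n).comp (-X) ∣ (expand F 2 g).comp (-X) := by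
      obtain ⟨q, hq⟩ := h
      rw [hq, mul_comp]
      exact dvd_mul_right _ _
    rw [h1] at h2
    have h3 : ((X - C ξ) ^ n).comp (-X) = (-1) ^ n * (X + C ξ) ^ n := by
      rw [← mul_pow]
      simp only [pow_comp, sub_comp, X_comp, C_comp]
      congr 1
      ring
    rw [h3] at h2
    exact (dvd_mul_left _ _).trans h2
  have hcop : IsCoprime ((X - C ξ) ^ n) ((X + C ξ) ^ n) := by
    refine IsCoprime.pow ?_
    have := isCoprime_X_sub_C_of_isUnit_sub (a := ξ) (b := -ξ) (by
      rw [sub_neg_eq_add, ← two_mul]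
      exact (mul_ne_zero h2 hξ).isUnit)
    simpa using this
  have h3 := hcop.mul_dvd h h'
  rw [← expand_two_eq] at h3
  have := dvd_slice (r := 0) two_pos h3
  rwa [slice_zero_expand two_pos] at this

/-- If one of the even and odd parts vanishes, parity forces the larger multiplicity `i` at both `ξ`
and `-ξ`. If neither does, only the common factor `(X ^ 2 - ξ ^ 2) ^ j` passes to the slices, but
there are two of them. -/
theorem exists_slices_of_dvd (h2 : (2 : F) ≠ 0) {ξ : F} (hξ : ξ ≠ 0) {i j L : ℕ} (hij : j ≤ i)
    {f : F[X]} (hf : f ≠ 0) (hdvd : (X - C ξ) ^ i * (X + C ξ) ^ j ∣ f)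
    (hdeg : f.degree < (2 * L : ℕ)) :
    (∃ u : F[X], u ≠ 0 ∧ (X - C (ξ ^ 2)) ^ i ∣ u ∧ u.degree < L ∧
      u.support.card ≤ f.support.card) ∨
    ∃ u v : F[X], u ≠ 0 ∧ v ≠ 0 ∧ (X - C (ξ ^ 2)) ^ j ∣ u ∧ (X - C (ξ ^ 2)) ^ j ∣ v ∧
      u.degree < L ∧ v.degree < L ∧ u.support.card + v.support.card ≤ f.support.card := by
  have hdeg' := fun r => degree_slice_lt two_pos r hdeg
  have hsum := sum_X_pow_mul_expand_slice two_pos f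
  have hcard := sum_card_support_slice two_pos f
  rw [← one_add_one_eq_two, Finset.sum_range_succ, Finset.sum_range_one, one_add_one_eq_two]
    at hsum hcard
  rw [pow_zero, one_mul, pow_one] at hsum
  have hi : (X - C ξ) ^ i ∣ f := (dvd_mul_right _ _).trans hdvd
  by_cases h1 : slice 2 1 f = 0
  · rw [h1, map_zero, mul_zero, add_zero] at hsum
    refine Or.inl ⟨slice 2 0 f, ?_, ?_, hdeg' 0, by omega⟩
    · intro h0
      rw [h0, map_zero] at hsum
      exact hf hsum.symm
    · rw [← hsum] at hi
      exact pow_dvd_of_dvd_expand_two h2 hξ hi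
  by_cases h0 : slice 2 0 f = 0
  · rw [h0, map_zero, zero_add] at hsum
    refine Or.inl ⟨slice 2 1 f, h1, ?_, hdeg' 1, by omega⟩
    rw [← hsum] at hi
    have hcop : IsCoprime ((X - C ξ) ^ i) (X : F[X]) := by
      refine IsCoprime.pow_left ?_
      have := isCoprime_X_sub_C_of_isUnit_sub (a := ξ) (b := 0) (by simpa using hξ)
      simpa using this
    exact pow_dvd_of_dvd_expand_two h2 hξ (hcop.dvd_of_dvd_mul_left hi)
  · have hj : expand F 2 ((X - C (ξ ^ 2)) ^ j) ∣ f := by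
      rw [expand_two_eq]
      exact (mul_dvd_mul (pow_dvd_pow _ hij) dvd_rfl).trans hdvd
    exact Or.inr ⟨_, _, h0, h1, dvd_slice two_pos hj, dvd_slice one_lt_two hj, hdeg' 0, hdeg' 1,
      hcard.le⟩

theorem expand_degree_lt {n L : ℕ} (hn : 0 < n) {g : F[X]} (hg : g ≠ 0) (h : g.degree < L) :
    (expand F n g).degree < (n * L : ℕ) := by
  rw [← natDegree_lt_iff_degree_lt ((expand_ne_zero hn).2 hg), natDegree_expand, mul_comm]
  rw [← natDegree_lt_iff_degree_lt hg] at h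
  exact Nat.mul_lt_mul_of_pos_left h hn

/-- Multiply an optimal word for the root `-ξ` by the binomial `(X - ξ) ^ p ^ s = X ^ p ^ s - ξ ^ p
^ s`, which absorbs any required power of `X - ξ` and at most doubles the weight. -/
theorem exists_two_mul_weight (p : ℕ) [hp : Fact p.Prime] [CharP F p] {s i j d : ℕ} {ξ : F}
    (hi : i ≤ p ^ s) (h : IsLeast (polyWeights ((X - C (-ξ)) ^ j) (p ^ s)) d) :
    ∃ g : F[X], g ≠ 0 ∧ (X - C ξ) ^ i * (X + C ξ) ^ j ∣ g ∧ g.degree < (2 * p ^ s : ℕ) ∧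
      g.support.card ≤ 2 * d := by
  obtain ⟨⟨u, hu, hdvd, hdeg, rfl⟩, -⟩ := h
  refine ⟨(X - C ξ) ^ p ^ s * u, mul_ne_zero (pow_ne_zero _ (X_sub_C_ne_zero ξ)) hu,
    mul_dvd_mul (pow_dvd_pow _ hi) (by simpa using hdvd), ?_, ?_⟩
  · have hne := mul_ne_zero (pow_ne_zero (p ^ s) (X_sub_C_ne_zero ξ)) hu
    rw [← natDegree_lt_iff_degree_lt hu] at hdeg
    rw [← natDegree_lt_iff_degree_lt hne, natDegree_mul (left_ne_zero_of_mul hne) hu,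
      natDegree_pow, natDegree_X_sub_C]
    omega
  · refine card_support_mul_le.trans (Nat.mul_le_mul_right _ ?_)
    have := X_sub_C_pow_char_pow p ξ s 1
    rw [mul_one] at this
    rw [this, card_support_expand (pow_pos hp.out.pos s)]
    exact card_support_X_sub_C_pow_le _ 1

theorem isLeast_polyWeights_two_roots (p : ℕ) [hp : Fact p.Prime] [CharP F p]
    (h2 : (2 : F) ≠ 0) {s i j d₁ d₂ : ℕ} (hij : j ≤ i) (hi : i ≤ p ^ s)
    (h₁ : ∀ a : F, a ≠ 0 → IsLeast (polyWeights ((X - C a) ^ i) (p ^ s)) d₁)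
    (h₂ : ∀ a : F, a ≠ 0 → IsLeast (polyWeights ((X - C a) ^ j) (p ^ s)) d₂)
    {ξ : F} (hξ : ξ ≠ 0) :
    IsLeast (polyWeights ((X - C ξ) ^ i * (X + C ξ) ^ j) (2 * p ^ s)) (min d₁ (2 * d₂)) := by
  have hξ2 := pow_ne_zero 2 hξ
  have hlow : ∀ f : F[X], f ≠ 0 → (X - C ξ) ^ i * (X + C ξ) ^ j ∣ f →
      f.degree < (2 * p ^ s : ℕ) → min d₁ (2 * d₂) ≤ f.support.card := by
    intro f hf hdvd hdeg
    rcases exists_slices_of_dvd h2 hξ hij hf hdvd hdeg with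
      ⟨u, hu, hud, hudeg, hc⟩ | ⟨u, v, hu, hv, hud, hvd, hudeg, hvdeg, hc⟩
    · have := (h₁ _ hξ2).2 ⟨u, hu, hud, hudeg, rfl⟩
      omega
    · have h3 := (h₂ _ hξ2).2 ⟨u, hu, hud, hudeg, rfl⟩
      have h4 := (h₂ _ hξ2).2 ⟨v, hv, hvd, hvdeg, rfl⟩
      omega
  rcases le_total d₁ (2 * d₂) with hle | hle
  · rw [min_eq_left hle] at hlow ⊢
    obtain ⟨⟨g, hg, hgd, hgdeg, hgc⟩, -⟩ := h₁ _ hξ2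
    -- The value `d₁` is attained by `g (X ^ 2)`, with `g` optimal for the root `ξ ^ 2`.
    refine isLeast_polyWeights hlow ((expand_ne_zero two_pos).2 hg) ?_
      (expand_degree_lt two_pos hg hgdeg) ((card_support_expand two_pos g).trans hgc).le
    refine (mul_dvd_mul dvd_rfl (pow_dvd_pow _ hij)).trans ?_
    rw [← expand_two_eq]
    exact expand_dvd_expand 2 hgd
  · rw [min_eq_right hle] at hlow ⊢
    obtain ⟨g, hg, hgd, hgdeg, hgc⟩ := exists_two_mul_weight p hi (h₂ _ (neg_ne_zero.2 hξ))
    exact isLeast_polyWeights hlow hg hgd hgdeg hgc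

theorem isLeast_polyWeights_full (p : ℕ) [hp : Fact p.Prime] [CharP F p]
    (h2 : (2 : F) ≠ 0) {s j d : ℕ} (hj : j ≤ p ^ s)
    (h : ∀ a : F, a ≠ 0 → IsLeast (polyWeights ((X - C a) ^ j) (p ^ s)) d)
    {ξ : F} (hξ : ξ ≠ 0) :
    IsLeast (polyWeights ((X - C ξ) ^ p ^ s * (X + C ξ) ^ j) (2 * p ^ s)) (2 * d) := by
  have hξ2 := pow_ne_zero 2 hξ
  obtain ⟨g, hg, hgd, hgdeg, hgc⟩ := exists_two_mul_weight p le_rfl (h _ (neg_ne_zero.2 hξ))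
  refine isLeast_polyWeights ?_ hg hgd hgdeg hgc
  intro f hf hdvd hdeg
  rcases exists_slices_of_dvd h2 hξ hj hf hdvd hdeg with
    ⟨u, hu, hud, hudeg, hc⟩ | ⟨u, v, hu, hv, hud, hvd, hudeg, hvdeg, hc⟩
  -- A one-slice word is impossible: the slice would be a nonzero multiple of a polynomial of degree
  -- `p ^ s` with degree below `p ^ s`.
  · have := degree_le_of_dvd hud hu
    rw [degree_X_sub_C_pow] at this
    exact absurd (this.trans_lt hudeg) (lt_irrefl _)
  · have h3 := (h _ hξ2).2 ⟨u, hu, hud, hudeg, rfl⟩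
    have h4 := (h _ hξ2).2 ⟨v, hv, hvd, hvdeg, rfl⟩
    omega

theorem isLeast_polyWeights_expand {n : ℕ} (hn : 0 < n) {G : F[X]} {L d : ℕ}
    (h : IsLeast (polyWeights G L) d) : IsLeast (polyWeights (expand F n G) (n * L)) d := by
  obtain ⟨⟨g, hg, hgd, hgdeg, hgc⟩, hlow⟩ := h
  refine isLeast_polyWeights ?_ ((expand_ne_zero hn).2 hg) (expand_dvd_expand n hgd)
    (expand_degree_lt hn hg hgdeg) ((card_support_expand hn g).trans hgc).le
  intro f hf hdvd hdeg
  obtain ⟨r, hr, hne⟩ := exists_slice_ne_zero hn hf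
  exact (hlow ⟨_, hne, dvd_slice hr hdvd, degree_slice_lt hn r hdeg, rfl⟩).trans
    (card_support_slice_le hr f)

end PolyWeights

end RepeatedRoot

/-! ### Constacyclic codes as ideals, and weights of words as weights of polynomials -/

namespace RepeatedRoot

theorem exists_associated_of_dvd_pow_mul_pow {F : Type*} [Field F] {A B G : F[X]} (hA : Irreducible A)
    (hB : Irreducible B) {n : ℕ} (h : G ∣ A ^ n * B ^ n) :
    ∃ i ≤ n, ∃ j ≤ n, Associated G (A ^ i * B ^ j) := by
  obtain ⟨u, v, hu, hv, rfl⟩ := exists_dvd_and_dvd_of_dvd_mul h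
  obtain ⟨i, hi, hui⟩ := (dvd_prime_pow hA.prime n).1 hu
  obtain ⟨j, hj, hvj⟩ := (dvd_prime_pow hB.prime n).1 hv
  exact ⟨i, hi, j, hj, hui.mul_mul hvj⟩

section Codes

variable {F : Type*} [Field F] [DecidableEq F]

theorem wordClass_eq_mk_ofFn (N : ℕ) (lam : F) (c : Fin N → F) :
    wordClass N lam c = Ideal.Quotient.mk (Ideal.span {(X ^ N - C lam : F[X])}) (ofFn N c) := by
  rw [ofFn_eq_sum_monomial, map_sum, wordClass, Fintype.linearCombination_apply]
  refine Finset.sum_congr rfl fun i _ => ?_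
  rw [← C_mul_X_pow_eq_monomial, ← smul_eq_C_mul]
  rfl

/-- As `G` divides the modulus, divisibility by `G` is insensitive to the choice of representative.
-/
theorem mem_codeOfIdeal_span {N : ℕ} {lam : F} {G : F[X]} (hG : G ∣ X ^ N - C lam)
    (c : Fin N → F) :
    c ∈ codeOfIdeal (Ideal.span
      {Ideal.Quotient.mk (Ideal.span {(X ^ N - C lam : F[X])}) G}) ↔ G ∣ ofFn N c := by
  change wordClass N lam c ∈ Ideal.span _ ↔ _
  rw [wordClass_eq_mk_ofFn, Ideal.mem_span_singleton]
  constructor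
  · rintro ⟨u, hu⟩
    obtain ⟨u, rfl⟩ := Ideal.Quotient.mk_surjective u
    rw [← map_mul, Ideal.Quotient.eq, Ideal.mem_span_singleton] at hu
    have := dvd_add (hG.trans hu) (dvd_mul_right G u)
    rwa [sub_add_cancel] at this
  · exact fun h => map_dvd _ h

theorem hammingNorm_eq_card_support {N : ℕ} (c : Fin N → F) :
    hammingNorm c = (ofFn N c).support.card := by
  rw [hammingNorm, ← Finset.card_map Fin.valEmbedding]
  congr 1
  ext k
  simp only [Finset.mem_map, Finset.mem_filter, Finset.mem_univ, true_and, mem_support_iff,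
    Fin.valEmbedding_apply]
  constructor
  · rintro ⟨i, hi, rfl⟩
    simpa using hi
  · intro hk
    by_cases h : k < N
    · exact ⟨⟨k, h⟩, by simpa [h] using hk, rfl⟩
    · exact absurd (ofFn_coeff_eq_zero_of_ge c (by omega)) hk

theorem ofFn_toFn_of_degree_lt {N : ℕ} {f : F[X]} (h : f.degree < N) : ofFn N (toFn N f) = f := by
  rw [degree_lt_iff_coeff_zero] at h
  ext k
  by_cases hk : k < N
  · simp [hk, toFn]
  · rw [ofFn_coeff_eq_zero_of_ge _ (by omega), h k (by omega)]

theorem hasHammingDistance_codeOfIdeal {N : ℕ} {lam : F} {G : F[X]} (hG : G ∣ X ^ N - C lam)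
    {d : ℕ} (h : IsLeast (polyWeights G N) d) :
    HasHammingDistance (codeOfIdeal (Ideal.span
      {Ideal.Quotient.mk (Ideal.span {(X ^ N - C lam : F[X])}) G})) d := by
  refine (congrArg (IsLeast · d) (Set.ext fun w => ?_)).mpr h
  constructor
  · rintro ⟨c, hc, hc0, rfl⟩
    exact ⟨ofFn N c, fun h0 => hc0 (injective_ofFn N (h0.trans (map_zero _).symm)),
      (mem_codeOfIdeal_span hG c).1 hc, ofFn_degree_lt c, (hammingNorm_eq_card_support c).symm⟩
  · rintro ⟨f, hf, hGf, hdeg, rfl⟩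
    have hof := ofFn_toFn_of_degree_lt hdeg
    refine ⟨toFn N f, (mem_codeOfIdeal_span hG _).2 (by rwa [hof]), fun h0 => ?_, ?_⟩
    · rw [h0, map_zero] at hof
      exact hf hof.symm
    · rw [hammingNorm_eq_card_support, hof]

theorem X_mul_ofFn {N : ℕ} (hN : 0 < N) (lam : F) (c : Fin N → F) :
    X * ofFn N c = ofFn N (constaShift lam c) +
      (X ^ N - C lam) * C (c ⟨N - 1, Nat.sub_one_lt_of_lt hN⟩) := by
  ext k
  rw [coeff_add, coeff_mul_C, coeff_sub, coeff_X_pow, coeff_C]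
  rcases k with _ | k
  · rw [mul_comm, coeff_mul_X_zero, ofFn_coeff_eq_val_of_lt _ hN, if_neg (by omega)]
    simp [constaShift]
  · rw [coeff_X_mul]
    rcases lt_trichotomy (k + 1) N with h | h | h
    · rw [ofFn_coeff_eq_val_of_lt _ h, ofFn_coeff_eq_val_of_lt _ (by omega), if_neg (by omega)]
      simp [constaShift]
    · subst h
      rw [ofFn_coeff_eq_zero_of_ge _ le_rfl, ofFn_coeff_eq_val_of_lt _ (by omega)]
      simp
    · rw [ofFn_coeff_eq_zero_of_ge _ h.le, ofFn_coeff_eq_zero_of_ge _ (by omega),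
        if_neg (by omega)]
      simp

theorem isConstacyclic_codeOfIdeal {N : ℕ} (hN : 0 < N) {lam : F} {G : F[X]}
    (hG : G ∣ X ^ N - C lam) : IsConstacyclic lam (codeOfIdeal (Ideal.span
      {Ideal.Quotient.mk (Ideal.span {(X ^ N - C lam : F[X])}) G})) := by
  intro c hc
  rw [mem_codeOfIdeal_span hG] at hc ⊢
  have h := X_mul_ofFn hN lam c
  rw [← sub_eq_iff_eq_add] at h
  rw [← h]
  exact dvd_sub (hc.mul_left _) (hG.mul_right _)

/-- Reduction modulo `q` turns multiplication by `X` into the shift, so the preimage of `D` in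
`F[X]` is an ideal. Its generator `G` divides `q` because `q` reduces to the zero word. -/
theorem IsConstacyclic.exists_eq_codeOfIdeal {N : ℕ} (hN : 0 < N) {lam : F}
    {D : Submodule F (Fin N → F)} (hD : IsConstacyclic lam D) :
    ∃ G : F[X], G ∣ X ^ N - C lam ∧ ∀ c, c ∈ D ↔ G ∣ ofFn N c := by
  set q : F[X] := X ^ N - C lam with hq
  have hmonic : q.Monic := monic_X_pow_sub_C lam hN.ne'
  have hqdeg : q.degree = N := degree_X_pow_sub_C hN lam
  let ℓ : F[X] →ₗ[F] (Fin N → F) := (toFn N).comp (modByMonicHom q)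
  have hof : ∀ f, ofFn N (ℓ f) = f %ₘ q := fun f =>
    ofFn_toFn_of_degree_lt (hqdeg ▸ degree_modByMonic_lt f hmonic)
  have huniq : ∀ (f : F[X]) (c : Fin N → F), q ∣ f - ofFn N c → ℓ f = c := by
    rintro f c ⟨g, hg⟩
    refine injective_ofFn N ?_
    rw [hof]
    refine (div_modByMonic_unique g _ hmonic ⟨?_, hqdeg ▸ ofFn_degree_lt c⟩).2
    rw [← hg]
    ring
  have hdvd : ∀ f, q ∣ f - ofFn N (ℓ f) := fun f => by
    rw [hof, modByMonic_eq_sub_mul_div, sub_sub_cancel]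
    exact dvd_mul_right _ _
  have hX : ∀ f, ℓ (X * f) = constaShift lam (ℓ f) := fun f => by
    refine huniq _ _ ?_
    have h : X * f - ofFn N (constaShift lam (ℓ f)) = X * (f - ofFn N (ℓ f)) +
        q * C (ℓ f ⟨N - 1, Nat.sub_one_lt_of_lt hN⟩) := by
      rw [mul_sub, X_mul_ofFn hN lam]
      ring
    rw [h]
    exact dvd_add ((hdvd f).mul_left _) (dvd_mul_right _ _)
  let J : Ideal F[X] :=
    { (D.comap ℓ).toAddSubmonoid with
      smul_mem' := by
        intro g f hf
        change ℓ f ∈ D at hf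
        change ℓ (g * f) ∈ D
        induction g using Polynomial.induction_on' with
        | add g g' hg hg' =>
          rw [add_mul, map_add]
          exact D.add_mem hg hg'
        | monomial n a =>
          rw [← C_mul_X_pow_eq_monomial, mul_assoc, ← smul_eq_C_mul, map_smul]
          refine D.smul_mem a ?_
          induction n with
          | zero => simpa using hf
          | succ n ih =>
            rw [pow_succ', mul_assoc, hX]
            exact hD _ ih }
  have hJ : ∀ f, f ∈ J ↔ ℓ f ∈ D := fun f => Iff.rfl
  obtain ⟨G, hG⟩ := IsPrincipalIdealRing.principal J
  have hJG : ∀ f, ℓ f ∈ D ↔ G ∣ f := fun f => by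
    rw [← hJ, hG]
    exact Ideal.mem_span_singleton
  refine ⟨G, (hJG q).1 ?_, fun c => ?_⟩
  · rw [huniq q 0 (by simp)]
    exact D.zero_mem
  · rw [← hJG, huniq (ofFn N c) c (by simp)]

theorem codeOfIdeal_span_one {N : ℕ} {lam : F} : codeOfIdeal (Ideal.span
      {Ideal.Quotient.mk (Ideal.span {(X ^ N - C lam : F[X])}) 1}) = ⊤ :=
  eq_top_iff.2 fun c _ => (mem_codeOfIdeal_span (one_dvd _) c).2 (one_dvd _)

theorem codeOfIdeal_span_self {N : ℕ} (hN : 0 < N) {lam : F} : codeOfIdeal (Ideal.span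
      {Ideal.Quotient.mk (Ideal.span {(X ^ N - C lam : F[X])}) (X ^ N - C lam)}) = ⊥ := by
  refine eq_bot_iff.2 fun c hc => ?_
  rw [mem_codeOfIdeal_span dvd_rfl] at hc
  have h0 := eq_zero_of_dvd_of_degree_lt hc
    ((ofFn_degree_lt c).trans_eq (degree_X_pow_sub_C hN lam).symm)
  exact injective_ofFn N (h0.trans (map_zero _).symm)

theorem isConstacyclic_iff_exists_codeIJ {N η n : ℕ} (hN : 0 < N) {lam ξ : F}
    (hq : (X ^ N - C lam : F[X]) = (X ^ η - C ξ) ^ n * (X ^ η + C ξ) ^ n)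
    (hA : Irreducible (X ^ η - C ξ : F[X])) (hB : Irreducible (X ^ η + C ξ : F[X]))
    (D : Submodule F (Fin N → F)) :
    IsConstacyclic lam D ↔ ∃ i ≤ n, ∃ j ≤ n, D = codeIJ N lam η ξ i j := by
  constructor
  · intro hD
    obtain ⟨G, hG, hc⟩ := hD.exists_eq_codeOfIdeal hN
    obtain ⟨i, hi, j, hj, hass⟩ := exists_associated_of_dvd_pow_mul_pow hA hB (hq ▸ hG)
    refine ⟨i, hi, j, hj, ?_⟩
    ext c
    rw [hc, codeIJ, mem_codeOfIdeal_span (hass.dvd'.trans hG), hass.dvd_iff_dvd_left]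
  · rintro ⟨i, hi, j, hj, rfl⟩
    refine isConstacyclic_codeOfIdeal hN ?_
    rw [hq]
    exact mul_dvd_mul (pow_dvd_pow _ hi) (pow_dvd_pow _ hj)

end Codes

end RepeatedRoot

namespace RepeatedRoot

/-! ### The blocks tile the exponents and the rows cover all pairs -/

section Blocks

/-- The `β` blocks are level `k = 0` of the `τ` blocks, with `τ = β + 1`; this lets one distance
formula serve both. -/
theorem InBetaBlock.inTauBlock {p s β i : ℕ} (h : InBetaBlock p s β i) :
    InTauBlock p s 0 (β + 1) i := by
  simpa [InTauBlock, InBetaBlock] using h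

theorem InTauBlock.inBetaBlock {p s τ i : ℕ} (hτ : 1 ≤ τ) (h : InTauBlock p s 0 τ i) :
    InBetaBlock p s (τ - 1) i := by
  have := Nat.sub_add_cancel hτ
  simpa [InTauBlock, InBetaBlock, this] using h

theorem InTauBlock.le {p s k τ i : ℕ} (hp : 0 < p) (hk : k < s) (hτ : τ ≤ p - 1)
    (h : InTauBlock p s k τ i) : i ≤ p ^ s - p ^ (s - (k + 1)) := by
  have h2 := h.2
  have h3 : p ^ (s - k) = p * p ^ (s - k - 1) := by
    rw [← pow_succ', Nat.sub_add_cancel (by omega)]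
  have h4 : p ^ (s - k) ≤ p ^ s := Nat.pow_le_pow_right hp (by omega)
  have h5 : τ * p ^ (s - k - 1) + p ^ (s - k - 1) ≤ p * p ^ (s - k - 1) := by
    rw [← Nat.succ_mul]
    exact Nat.mul_le_mul_right _ (by omega)
  rw [Nat.sub_add_eq s k 1]
  omega

theorem InTauBlock.lt_pow {p s k τ i : ℕ} (hp : 0 < p) (hk : k < s) (hτ : τ ≤ p - 1)
    (h : InTauBlock p s k τ i) : i < p ^ s := by
  have h1 := h.le hp hk hτ
  have h2 : 0 < p ^ (s - (k + 1)) := by positivity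
  have h3 : 0 < p ^ s := by positivity
  omega

theorem InTauBlock.lt_of_level_lt {p s k k' τ τ' i j : ℕ} (hp : 0 < p) (hk : k' < k) (hks : k < s)
    (hτ' : τ' ≤ p - 1) (hi : InTauBlock p s k τ i) (hj : InTauBlock p s k' τ' j) : j < i := by
  have h1 := hj.le hp (by omega) hτ'
  have h2 := hi.1
  have h3 : p ^ (s - k) ≤ p ^ (s - (k' + 1)) := Nat.pow_le_pow_right hp (by omega)
  omega

theorem InTauBlock.lt_of_lt {p s k τ τ' i j : ℕ} (hτ : τ' < τ)
    (hi : InTauBlock p s k τ i) (hj : InTauBlock p s k τ' j) : j < i := by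
  have h1 := hj.2
  have h2 := hi.1
  have h3 : τ' * p ^ (s - k - 1) ≤ (τ - 1) * p ^ (s - k - 1) :=
    Nat.mul_le_mul_right _ (by omega)
  omega

/-- Level `k` fills the interval from `p ^ s - p ^ (s - k)` (excluded) to `p ^ s - p ^ (s - (k +
1))` (included); at `k = s` the right end `p ^ s - 1` is reached. -/
theorem exists_inTauBlock {p s i : ℕ} (hp : 0 < p) (hi : 0 < i) (his : i < p ^ s) :
    ∃ k < s, ∃ τ, 1 ≤ τ ∧ τ ≤ p - 1 ∧ InTauBlock p s k τ i := by
  have key : ∀ k ≤ s, i ≤ p ^ s - p ^ (s - k) →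
      ∃ k < s, ∃ τ, 1 ≤ τ ∧ τ ≤ p - 1 ∧ InTauBlock p s k τ i := by
    intro k
    induction k with
    | zero =>
      intro _ h
      simp at h
      omega
    | succ k ih =>
      intro hk h
      by_cases h' : i ≤ p ^ s - p ^ (s - k)
      · exact ih (by omega) h'
      set P := p ^ (s - k - 1) with hP
      have hP0 : 0 < P := by positivity
      have h3 : p ^ (s - k) = p * P := by
        rw [hP, ← pow_succ', Nat.sub_add_cancel (by omega)]
      have h4 : p ^ (s - k) ≤ p ^ s := Nat.pow_le_pow_right hp (by omega)
      rw [Nat.sub_add_eq s k 1] at h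
      -- The shift by one accounts for blocks that exclude their left end, so that `τ - 1` is the
      -- quotient of `r` by the block length `P`.
      set r := i - 1 - (p ^ s - p ^ (s - k)) with hr
      have hdm := Nat.div_add_mod r P
      have hmod := Nat.mod_lt r hP0
      have hle : P ≤ p * P := Nat.le_mul_of_pos_left _ hp
      have hrlt : r < (p - 1) * P := by
        rw [Nat.sub_mul, one_mul]
        omega
      have hq : r / P < p - 1 := (Nat.div_lt_iff_lt_mul hP0).2 hrlt
      refine ⟨k, by omega, r / P + 1, Nat.succ_pos _, hq, ?_, ?_⟩
      · rw [Nat.add_sub_cancel, ← hP, mul_comm]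
        omega
      · rw [← hP, add_mul, one_mul, mul_comm]
        omega
  refine key s le_rfl ?_
  rw [Nat.sub_self, pow_zero]
  omega

theorem exists_distanceTable_of_blocks {p s : ℕ} (hp : 3 ≤ p) {k k' τ τ' i j : ℕ}
    (hk : k < s) (hτ : 1 ≤ τ) (hτp : τ ≤ p - 1) (hi : InTauBlock p s k τ i)
    (hτ' : 1 ≤ τ') (hτp' : τ' ≤ p - 1) (hj : InTauBlock p s k' τ' j)
    (hlex : k' < k ∨ k' = k ∧ τ' ≤ τ) : ∃ d, DistanceTable p s i j d := by
  have hs : p ^ (s - 1) ≤ p ^ s := Nat.pow_le_pow_right (by omega) (by omega)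
  have his := (hi.lt_pow (by omega) hk hτp).le
  rcases Nat.eq_zero_or_pos k' with rfl | hk'
  · have hj' := hj.inBetaBlock hτ'
    have hj0 : 0 < j := by have := hj.1; omega
    rcases Nat.eq_or_lt_of_le hτ' with rfl | hτ'1
    · have hj1 : j ≤ p ^ (s - 1) := by simpa [InBetaBlock] using hj'.2
      by_cases h1 : i ≤ p ^ (s - 1)
      · exact ⟨_, .both_small i j h1 hj1⟩
      by_cases h2 : i ≤ 2 * p ^ (s - 1)
      · exact ⟨_, .three i j (by omega) h2 hj0 hj1⟩
      · exact ⟨_, .four i j (by omega) his hj0 hj1⟩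
    · rcases Nat.eq_zero_or_pos k with rfl | hk0
      · exact ⟨_, .beta_beta i j (τ - 1) (τ' - 1) (by omega) (by omega) (by omega)
          (hi.inBetaBlock hτ) hj'⟩
      · exact ⟨_, .tau_beta i j k τ (τ' - 1) hk0 (by omega) hτ hτp (by omega) (by omega) hi hj'⟩
  · rcases hlex with h | ⟨rfl, h⟩
    · exact ⟨_, .level_lt i j k k' τ τ' hk' h (by omega) hτ hτp hτ' hτp' hi hj⟩
    · rcases Nat.eq_or_lt_of_le h with rfl | h
      · exact ⟨_, .tau_eq i j k' τ' hk' (by omega) hτ hτp hi hj⟩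
      · exact ⟨_, .tau_lt i j k' τ τ' hk' (by omega) hτ' h hτp hi hj⟩

theorem exists_distanceTable_full {p s j : ℕ} (hp : 3 ≤ p) (hs : 0 < s) (hj : j < p ^ s) :
    ∃ d, DistanceTable p s (p ^ s) j d := by
  rcases Nat.eq_zero_or_pos j with rfl | hj0
  · exact ⟨_, .right_zero _ hj le_rfl⟩
  obtain ⟨k, hk, τ, hτ, hτp, hb⟩ := exists_inTauBlock (by omega) hj0 hj
  rcases Nat.eq_zero_or_pos k with rfl | hk0
  · have hb' := hb.inBetaBlock hτ
    rcases Nat.eq_or_lt_of_le hτ with rfl | hτ1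
    · have hj1 : j ≤ p ^ (s - 1) := by simpa [InBetaBlock] using hb'.2
      refine ⟨_, .four _ j ?_ le_rfl hj0 hj1⟩
      have h0 : 0 < p ^ (s - 1) := by positivity
      calc 2 * p ^ (s - 1) < p * p ^ (s - 1) := Nat.mul_lt_mul_of_pos_right (by omega) h0
        _ = p ^ s := by rw [← pow_succ', Nat.sub_add_cancel (by omega)]
    · exact ⟨_, .full_beta j (τ - 1) (by omega) (by omega) hb'⟩
  · exact ⟨_, .full_tau j k τ hk0 (by omega) hτ hτp hb⟩

theorem exists_distanceTable {p s i j : ℕ} (hp : 3 ≤ p) (hs : 0 < s) (hi : i ≤ p ^ s)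
    (hj : j ≤ p ^ s) (h0 : (i, j) ≠ (0, 0)) (h1 : (i, j) ≠ (p ^ s, p ^ s)) :
    ∃ d, DistanceTable p s i j d ∨ DistanceTable p s j i d := by
  simp only [ne_eq, Prod.mk.injEq, not_and] at h0 h1
  rcases Nat.eq_or_lt_of_le hi with rfl | hi'
  · have := h1 rfl
    obtain ⟨d, hd⟩ := exists_distanceTable_full hp hs (lt_of_le_of_ne hj this)
    exact ⟨d, .inl hd⟩
  rcases Nat.eq_or_lt_of_le hj with rfl | hj'
  · obtain ⟨d, hd⟩ := exists_distanceTable_full hp hs hi'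
    exact ⟨d, .inr hd⟩
  rcases Nat.eq_zero_or_pos i with rfl | hi0
  · exact ⟨_, .inr (.right_zero j (Nat.pos_of_ne_zero (h0 rfl)) hj)⟩
  rcases Nat.eq_zero_or_pos j with rfl | hj0
  · exact ⟨_, .inl (.right_zero i hi0 hi)⟩
  obtain ⟨k, hk, τ, hτ, hτp, hb⟩ := exists_inTauBlock (by omega) hi0 hi'
  obtain ⟨k', hk', τ', hτ', hτp', hb'⟩ := exists_inTauBlock (by omega) hj0 hj'
  by_cases hlex : k' < k ∨ k' = k ∧ τ' ≤ τ
  · obtain ⟨d, hd⟩ := exists_distanceTable_of_blocks hp hk hτ hτp hb hτ' hτp' hb' hlex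
    exact ⟨d, .inl hd⟩
  · obtain ⟨d, hd⟩ := exists_distanceTable_of_blocks hp hk' hτ' hτp' hb' hτ hτp hb (by omega)
    exact ⟨d, .inr hd⟩

end Blocks

/-! ### Evaluating the rows -/

section Table

variable (F : Type*) [Field F]

/-- `d` is the minimum weight of the nonzero multiples of `(X - a) ^ i` of degree less than
`p ^ s`, for every `a ≠ 0`. -/
def SingleDistance (p s i d : ℕ) : Prop :=
  ∀ a : F, a ≠ 0 → IsLeast (polyWeights ((X - C a) ^ i) (p ^ s)) d

/-- `d` is the minimum weight of the nonzero multiples of `(X - ξ) ^ i * (X + ξ) ^ j` of degree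
less than `2 * p ^ s`, for every `ξ ≠ 0`. -/
def PairDistance (p s i j d : ℕ) : Prop :=
  ∀ ξ : F, ξ ≠ 0 → IsLeast (polyWeights ((X - C ξ) ^ i * (X + C ξ) ^ j) (2 * p ^ s)) d

variable {F}

/-- Replacing `ξ` by `-ξ` exchanges the two factors; this is why `PairDistance` quantifies over all
nonzero `ξ`. -/
theorem PairDistance.symm {p s i j d : ℕ} (h : PairDistance F p s i j d) :
    PairDistance F p s j i d := by
  intro ξ hξ
  have := h (-ξ) (neg_ne_zero.2 hξ)
  rwa [C_neg, sub_neg_eq_add, ← sub_eq_add_neg, mul_comm] at this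

theorem singleDistance_zero {p s : ℕ} [hp : Fact p.Prime] : SingleDistance F p s 0 1 := fun a _ => by
  rw [pow_zero]
  exact isLeast_polyWeights_one (pow_pos hp.out.pos s)

variable {p : ℕ} [hp : Fact p.Prime] [CharP F p] {s i j d d₁ d₂ : ℕ}

theorem InTauBlock.singleDistance {k τ : ℕ} (hi : InTauBlock p s k τ i) (hk : k < s)
    (hτ : 1 ≤ τ) (hτ' : τ ≤ p - 1) : SingleDistance F p s i ((τ + 1) * p ^ k) :=
  fun _ ha => isLeast_polyWeights_single p hk hτ hτ' hi ha

theorem InBetaBlock.singleDistance {β : ℕ} (hi : InBetaBlock p s β i) (hs : 0 < s)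
    (hβ : β ≤ p - 2) : SingleDistance F p s i (β + 2) := by
  have h2 := hp.out.two_le
  have := hi.inTauBlock.singleDistance (F := F) hs (by omega) (by omega)
  rwa [pow_zero, mul_one] at this

theorem SingleDistance.pair (h2 : (2 : F) ≠ 0) (hij : j ≤ i) (hi : i ≤ p ^ s)
    (h₁ : SingleDistance F p s i d₁) (h₂ : SingleDistance F p s j d₂) (hd : d = min d₁ (2 * d₂)) :
    PairDistance F p s i j d := fun _ hξ =>
  hd ▸ isLeast_polyWeights_two_roots p h2 hij hi h₁ h₂ hξ

theorem SingleDistance.pair_full (h2 : (2 : F) ≠ 0) (hj : j ≤ p ^ s)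
    (h : SingleDistance F p s j d₁) (hd : d = 2 * d₁) :
    PairDistance F p s (p ^ s) j d := fun _ hξ =>
  hd ▸ isLeast_polyWeights_full p h2 hj h hξ

/-- Two exponents in one block may come in either order; since `min d (2 * d) = d`, the order is
irrelevant. -/
theorem pairDistance_self_level (h2 : (2 : F) ≠ 0) (hi : i ≤ p ^ s) (hj : j ≤ p ^ s)
    (h₁ : SingleDistance F p s i d) (h₂ : SingleDistance F p s j d) :
    PairDistance F p s i j d := by
  rcases le_total j i with h | h
  · exact h₁.pair h2 h hi h₂ (by omega)
  · exact (h₂.pair h2 h hj h₁ (by omega)).symm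

theorem pairDistance_right_zero (h2 : (2 : F) ≠ 0) (hi : 0 < i) (hi' : i ≤ p ^ s) :
    PairDistance F p s i 0 2 := by
  have hp2 := hp.out.two_le
  rcases Nat.eq_or_lt_of_le hi' with rfl | hlt
  · exact singleDistance_zero.pair_full h2 (Nat.zero_le _) rfl
  · obtain ⟨k, hk, τ, hτ, hτp, hb⟩ := exists_inTauBlock (by omega) hi hlt
    refine (hb.singleDistance hk hτ hτp).pair h2 (Nat.zero_le _) hi' singleDistance_zero ?_
    have : 0 < p ^ k := by positivity
    rw [min_eq_right]
    nlinarith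

theorem pairDistance_four (h2 : (2 : F) ≠ 0) (hp3 : 3 ≤ p) (hs : 0 < s)
    (hi : 2 * p ^ (s - 1) < i) (hi' : i ≤ p ^ s) (hj : 0 < j) (hj' : j ≤ p ^ (s - 1)) :
    PairDistance F p s i j 4 := by
  have hS : SingleDistance F p s j 2 :=
    InBetaBlock.singleDistance (β := 0) (by simp [InBetaBlock]; omega) hs (by omega)
  rcases Nat.eq_or_lt_of_le hi' with rfl | hlt
  · exact hS.pair_full h2 (by omega) rfl
  · obtain ⟨k, hk, τ, hτ, hτp, hb⟩ := exists_inTauBlock (by omega) (by omega : 0 < i) hlt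
    refine (hb.singleDistance hk hτ hτp).pair h2 (by omega) hi' hS ?_
    refine (min_eq_right ?_).symm
    rcases Nat.eq_zero_or_pos k with rfl | hk0
    · have h3 := (hb.inBetaBlock hτ).2
      rw [Nat.sub_add_cancel hτ] at h3
      -- At level `0` this makes the single distance `τ + 1` at least `4`; at higher levels it is at
      -- least `2 * p`.
      have : 2 < τ := lt_of_mul_lt_mul_right (hi.trans_le h3) (Nat.zero_le _)
      rw [pow_zero]
      omega
    · have : p ^ 1 ≤ p ^ k := Nat.pow_le_pow_right (by omega) hk0
      nlinarith

/-- The row `both_small` formally contains `(0, 0)`, where the distance is `1`; hence the exclusion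
`h0`. -/
theorem DistanceTable.pairDistance (hp3 : 3 ≤ p) (hs : 0 < s) (h : DistanceTable p s i j d)
    (h2 : (2 : F) ≠ 0) (h0 : (i, j) ≠ (0, 0)) (hi : i ≤ p ^ s) (hj : j ≤ p ^ s) :
    PairDistance F p s i j d := by
  have hp0 : 0 < p := by omega
  have hps : p ^ s = p * p ^ (s - 1) := by
    rw [← pow_succ', Nat.sub_add_cancel (by omega)]
  cases h with
  | right_zero _ hi0 hi' => exact pairDistance_right_zero h2 hi0 hi
  | both_small _ _ hi' hj' =>
    rcases Nat.eq_zero_or_pos j with rfl | hj0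
    · exact pairDistance_right_zero h2 (Nat.pos_of_ne_zero fun h => h0 (by rw [h])) hi
    rcases Nat.eq_zero_or_pos i with rfl | hi0
    · exact (pairDistance_right_zero h2 hj0 hj).symm
    exact pairDistance_self_level h2 hi hj
      (InBetaBlock.singleDistance (β := 0) (by simp [InBetaBlock]; omega) hs (by omega))
      (InBetaBlock.singleDistance (β := 0) (by simp [InBetaBlock]; omega) hs (by omega))
  | three _ _ hi1 hi2 hj0 hj1 =>
    exact SingleDistance.pair h2 (by omega) hi
      (InBetaBlock.singleDistance (β := 1) (by simp [InBetaBlock]; omega) hs (by omega))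
      (InBetaBlock.singleDistance (β := 0) (by simp [InBetaBlock]; omega) hs (by omega)) rfl
  | four _ _ hi1 hi2 hj0 hj1 => exact pairDistance_four h2 hp3 hs hi1 hi hj0 hj1
  | beta_beta _ _ β β' hβ' hβ hβp hi' hj' =>
    have S := hi'.singleDistance (F := F) hs hβp
    have S' := hj'.singleDistance (F := F) hs (by omega)
    rcases Nat.eq_or_lt_of_le hβ with rfl | hlt
    · rw [min_eq_left (by omega)]
      exact pairDistance_self_level h2 hi hj S S'
    · exact S.pair h2 (hi'.inTauBlock.lt_of_lt (by omega) hj'.inTauBlock).le hi S' rfl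
  | tau_beta _ _ k τ β hk hk' hτ hτ' hβ hβ' hi' hj' =>
    refine (hi'.singleDistance (by omega) hτ hτ').pair h2
      (hi'.lt_of_level_lt hp0 hk (by omega) (by omega) hj'.inTauBlock).le hi
      (hj'.singleDistance hs hβ') (min_eq_right ?_).symm
    have : p ≤ p ^ k := Nat.le_self_pow (by omega) p
    calc 2 * (β + 2) ≤ 2 * p ^ k := by omega
      _ ≤ _ := Nat.mul_le_mul_right _ (by omega)
  | tau_eq _ _ k τ hk hk' hτ hτ' hi' hj' =>
    exact pairDistance_self_level h2 hi hj (hi'.singleDistance (by omega) hτ hτ')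
      (hj'.singleDistance (by omega) hτ hτ')
  | tau_lt _ _ k τ₁ τ₂ hk hk' hτ₂ hτ hτ₁ hi' hj' =>
    refine (hi'.singleDistance (by omega) (by omega) hτ₁).pair h2 (hi'.lt_of_lt hτ hj').le hi
      (hj'.singleDistance (by omega) hτ₂ (by omega)) ?_
    rw [min_comm, mul_assoc]
  | level_lt _ _ k' k'' τ₃ τ₄ hk'' hk hk' hτ₃ hτ₃' hτ₄ hτ₄' hi' hj' =>
    refine (hi'.singleDistance (by omega) hτ₃ hτ₃').pair h2
      (hi'.lt_of_level_lt hp0 hk (by omega) hτ₄' hj').le hi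
      (hj'.singleDistance (by omega) hτ₄ hτ₄') ?_
    rw [mul_assoc, min_eq_right]
    -- Since `τ₄ + 1 ≤ p`, the weight at level `k''` is at most `p ^ (k'' + 1) ≤ p ^ k'`, so
    -- doubling it cannot exceed the weight at level `k'`.
    refine Nat.mul_le_mul (by omega) ?_
    calc (τ₄ + 1) * p ^ k'' ≤ p * p ^ k'' := Nat.mul_le_mul_right _ (by omega)
      _ = p ^ (k'' + 1) := (pow_succ' _ _).symm
      _ ≤ p ^ k' := Nat.pow_le_pow_right hp0 hk
  | full_beta _ β hβ hβ' hj' => exact (hj'.singleDistance hs hβ').pair_full h2 hj rfl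
  | full_tau _ k τ hk hk' hτ hτ' hj' =>
    exact (hj'.singleDistance (by omega) hτ hτ').pair_full h2 hj (mul_assoc _ _ _)

end Table

/-! ### The negacyclic case and the final assembly -/

theorem exists_sq_add_one_factorization {F : Type*} [Field F] {ξ : F} (h : ξ * ξ = -1) :
    ξ ≠ 0 ∧ (X ^ (2 * 1) - C (-1) : F[X]) = (X ^ 1 - C ξ) * (X ^ 1 + C ξ) ∧
      Irreducible (X ^ 1 - C ξ : F[X]) ∧ Irreducible (X ^ 1 + C ξ : F[X]) := by
  refine ⟨?_, ?_, ?_, ?_⟩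
  · rintro rfl
    simp at h
  · rw [← h, C_mul]
    ring
  · rw [pow_one]
    exact irreducible_X_sub_C ξ
  · rw [pow_one, ← sub_neg_eq_add, ← C_neg]
    exact irreducible_X_sub_C (-ξ)

end RepeatedRoot

theorem theorem8p22 (p : ℕ) (hp : p.Prime) (hodd : Odd p) (m s : ℕ) (hs : 0 < s)
    (F : Type*) [Field F] [DecidableEq F] (hF : Nat.card F = p ^ m) :
    -- the codes and their Hamming distances
    (∀ (η : ℕ) (lam ξ ψ : F), 0 < η → lam ≠ 0 → ξ ≠ 0 → ψ ≠ 0 → lam = ψ ^ p ^ s →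
      (X ^ (2 * η) - C ψ : F[X]) = (X ^ η - C ξ) * (X ^ η + C ξ) →
      Irreducible (X ^ η - C ξ : F[X]) → Irreducible (X ^ η + C ξ : F[X]) →
      (∀ D : Submodule F (Fin (2 * η * p ^ s) → F),
        RepeatedRoot.IsConstacyclic lam D ↔
          ∃ i ≤ p ^ s, ∃ j ≤ p ^ s, D = RepeatedRoot.codeIJ (2 * η * p ^ s) lam η ξ i j) ∧
      RepeatedRoot.codeIJ (2 * η * p ^ s) lam η ξ 0 0 = ⊤ ∧
      RepeatedRoot.codeIJ (2 * η * p ^ s) lam η ξ (p ^ s) (p ^ s) = ⊥ ∧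
      ∀ i ≤ p ^ s, ∀ j ≤ p ^ s, (i, j) ≠ (0, 0) → (i, j) ≠ (p ^ s, p ^ s) →
        (∃ d, RepeatedRoot.DistanceTable p s i j d ∨ RepeatedRoot.DistanceTable p s j i d) ∧
        ∀ d, RepeatedRoot.DistanceTable p s i j d ∨ RepeatedRoot.DistanceTable p s j i d →
          RepeatedRoot.HasHammingDistance
            (RepeatedRoot.codeIJ (2 * η * p ^ s) lam η ξ i j) d) ∧
    -- the hypotheses hold for the negacyclic codes of length `2 * p ^ s` (with `η = 1` and
    -- `lam = ψ = -1`), unless `p ≡ 3 (mod 4)` and `m` is odd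
    (¬ (p % 4 = 3 ∧ Odd m) →
      (-1 : F) = (-1) ^ p ^ s ∧
      ∃ ξ : F, ξ ≠ 0 ∧ (X ^ (2 * 1) - C (-1) : F[X]) = (X ^ 1 - C ξ) * (X ^ 1 + C ξ) ∧
        Irreducible (X ^ 1 - C ξ : F[X]) ∧ Irreducible (X ^ 1 + C ξ : F[X])) := by
  have : Fact p.Prime := ⟨hp⟩
  have : Finite F := Nat.finite_of_card_ne_zero (by rw [hF]; exact pow_ne_zero _ hp.ne_zero)
  have : Fintype F := Fintype.ofFinite F
  rw [Nat.card_eq_fintype_card] at hF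
  have : CharP F p := charP_of_card_eq_prime_pow hF
  have hp3 : 3 ≤ p := by
    have := hp.two_le
    rcases hodd with ⟨c, rfl⟩
    omega
  have h2 : (2 : F) ≠ 0 := fun h => by
    have := (CharP.cast_eq_zero_iff F p 2).1 (by exact_mod_cast h)
    exact absurd (Nat.le_of_dvd two_pos this) (by omega)
  constructor
  · intro η lam ξ ψ hη _ hξ _ hlam hψ hA hB
    have hN : 0 < 2 * η * p ^ s := by positivity
    -- By Frobenius, the modulus is the `p ^ s`-th power of `X ^ (2 * η) - ψ`.
    have hq : (X ^ (2 * η * p ^ s) - C lam : F[X]) =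
        (X ^ η - C ξ) ^ p ^ s * (X ^ η + C ξ) ^ p ^ s := by
      rw [← mul_pow, ← hψ, sub_pow_char_pow, ← pow_mul, hlam, C_pow]
    refine ⟨RepeatedRoot.isConstacyclic_iff_exists_codeIJ hN hq hA hB, ?_, ?_, ?_⟩
    · rw [RepeatedRoot.codeIJ, pow_zero, pow_zero, one_mul, RepeatedRoot.codeOfIdeal_span_one]
    · rw [RepeatedRoot.codeIJ, ← hq, RepeatedRoot.codeOfIdeal_span_self hN]
    · intro i hi j hj h0 h1
      refine ⟨RepeatedRoot.exists_distanceTable hp3 hs hi hj h0 h1, fun d hd => ?_⟩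
      have hpair : RepeatedRoot.PairDistance F p s i j d := by
        rcases hd with hd | hd
        · exact hd.pairDistance hp3 hs h2 h0 hi hj
        · exact (hd.pairDistance hp3 hs h2 (fun h => h0 (by simp_all)) hj hi).symm
      -- The linear factors `X ∓ ξ` become `X ^ η ∓ ξ`.
      have hexp := RepeatedRoot.isLeast_polyWeights_expand hη (hpair ξ hξ)
      have hG : expand F η ((X - C ξ) ^ i * (X + C ξ) ^ j) =
          (X ^ η - C ξ) ^ i * (X ^ η + C ξ) ^ j := by
        rw [map_mul, map_pow, map_pow, map_sub, map_add, expand_X, expand_C]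
      have hL : η * (2 * p ^ s) = 2 * η * p ^ s := by ring
      rw [hG, hL] at hexp
      refine RepeatedRoot.hasHammingDistance_codeOfIdeal ?_ hexp
      rw [hq]
      exact mul_dvd_mul (pow_dvd_pow _ hi) (pow_dvd_pow _ hj)
  · intro h
    refine ⟨(Odd.neg_one_pow hodd.pow).symm, ?_⟩
    -- `-1` is a square unless `p ^ m ≡ 3 (mod 4)`; for odd `p` that congruence forces `m` odd and
    -- `p ≡ 3 (mod 4)`.
    have hsq : IsSquare (-1 : F) := by
      rw [FiniteField.isSquare_neg_one_iff, hF]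
      intro h3
      refine h ?_
      rcases Nat.even_or_odd m with ⟨c, rfl⟩ | hm
      · rw [← two_mul, pow_mul, Nat.pow_mod, Nat.pow_mod p 2] at h3
        have h1 : p % 4 = 1 ∨ p % 4 = 3 := by
          rcases hodd with ⟨c, rfl⟩
          omega
        rcases h1 with h1 | h1 <;> simp [h1] at h3
      · refine ⟨?_, hm⟩
        obtain ⟨c, rfl⟩ := hm
        have h1 : p % 4 = 1 ∨ p % 4 = 3 := by
          rcases hodd with ⟨c, rfl⟩
          omega
        rcases h1 with h1 | h1
        · rw [Nat.pow_mod, h1] at h3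
          simp at h3
        · exact h1
    obtain ⟨ξ, hξ⟩ := hsq
    exact ⟨ξ, RepeatedRoot.exists_sq_add_one_factorization hξ.symm⟩
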